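/- Let $U=\{z\in\mathbb{C}:|z|<1\}$, let $\{a_n\}_{n\ge1}$ be an infinite sequence with $0<|a_n|<1$ for all $n$ and $\sum_{n}(1-|a_n|)<\infty$, and let \[B(z)=\prod_{n=1}^{\infty}\frac{\bar a_n}{|a_n|}\,\frac{a_n-z}{1-\bar a_n z},\qquad z\in U,\] be the infinite Blaschke product with zeros $\{a_n\}$. Suppose that $\{a_n\}$ is uniformly discrete: there is a $\delta>0$ such that $\left|\frac{a_m-a_n}{1-\bar a_n a_m}\right|\ge\delta$ for all $m\ne n$. Let $\alpha$ and $p$ be real numbers with $\alpha>-1$ and $\alpha+1<p<\alpha+2$. If $B'\in A^p_\alpha$, that is, if \[\iint_U |B'(z)|^p(1-|z|)^\alpha\,dA(z)<\infty,\] where $dA$ is Lebesgue area measure and $B'$ is analytic in $U$, then \[\sum_{n}(1-|a_n|)^{2-p+\alpha}<\infty.\] -/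

import Mathlib

open scoped ComplexConjugate

noncomputable section

/-- The pseudohyperbolic metric of the open unit disc. -/
def pseudohyperbolicDist (z w : ℂ) : ℝ := ‖(z - w) / (1 - conj w * z)‖

/-- A sequence is uniformly discrete (separated) if distinct terms have pseudohyperbolic distance
bounded below by a positive constant. -/
def UniformlyDiscrete (a : ℕ → ℂ) : Prop :=
  ∃ δ : ℝ, 0 < δ ∧ ∀ m n : ℕ, m ≠ n → δ ≤ pseudohyperbolicDist (a m) (a n)

/-- An infinite sequence of points of the punctured unit disc that satisfies the Blaschke
condition. -/
structure IsBlaschkeSequence (a : ℕ → ℂ) : Prop where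
  norm_pos : ∀ n, 0 < ‖a n‖
  norm_lt_one : ∀ n, ‖a n‖ < 1
  summable : Summable fun n => 1 - ‖a n‖

/-- The infinite Blaschke product with zeros `a`, as a function on the plane; only its values on
the open unit disc matter. -/
def blaschkeProduct (a : ℕ → ℂ) (z : ℂ) : ℂ :=
  ∏' n : ℕ, conj (a n) / (‖a n‖ : ℂ) * ((a n - z) / (1 - conj (a n) * z))

/-- Membership in the weighted Bergman space of exponent `p` and weight `(1 - |z|) ^ α`: the
function is analytic in the open unit disc `U`, and the integral of `|f(z)| ^ p (1 - |z|) ^ α` over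
`U` with respect to Lebesgue area measure is finite. -/
structure MemBergman (p α : ℝ) (f : ℂ → ℂ) : Prop where
  analytic : AnalyticOnNhd ℂ f (Metric.ball 0 1)
  integrable : MeasureTheory.IntegrableOn (fun z : ℂ => ‖f z‖ ^ p * (1 - ‖z‖) ^ α)
    (Metric.ball 0 1) MeasureTheory.volume

end

/-!
Write `B` for the Blaschke product and put `q = p + 1`. Cauchy's estimate gives
`|B'(z)| ≤ 2 / (1 - |z|)`, so the hypothesis implies `∫ |B'|^q (1 - |z|)^(α + 1) dA < ∞`: the
exponent `p`, which may be less than `1`, is replaced by `q > 1`, while `2 - p + α` and the condition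
`α + 1 < p` are unchanged.

The function `B` is inner. Only a mean version is needed: the integral of `1 - |B|` over the circle
of radius `r` tends to `0` as `r → 1`. To see this, split off the first `N` factors. Their product
has modulus tending to `1` uniformly, and by the mean value property the tail product has mean
modulus at least its modulus at `0`, which is at least `1 - ∑_{n ≥ N} (1 - |aₙ|)`
(`IsBlaschkeSequence.tendsto_lintegral_one_sub_norm_blaschkeProduct`). Therefore `1 - |B|` at radius
`r` is dominated, in `L^q` of the angle, by `∫_r^1 |B'|` along radii, and Hardy's inequality
(`hardy_lintegral_le`, where `α + 1 < p` enters) yields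
`∫ (1 - |B|)^q (1 - |z|)^(α - p) dA < ∞` (`lintegral_one_sub_norm_rpow_lt_top`).

Finally, for a small constant `c`, separation makes the discs with centre `aₙ` and radius
`c (1 - |aₙ|)` pairwise disjoint, and `|B| ≤ c ≤ 1/2` on each of them because the `n`-th factor is
already that small. The disc about `aₙ` thus contributes at least a constant multiple of
`(1 - |aₙ|)^2 (1 - |aₙ|)^(α - p)` to the last integral, and these contributions have a finite sum.
-/

open scoped ComplexConjugate ENNReal Real
open Filter Topology Metric Set MeasureTheory

/-! ### Blaschke factors and Blaschke products -/

/-- The elementary factor of a Blaschke product with its zero at `a`, normalised to be positive at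
the origin. -/
noncomputable def blaschkeFactor (a z : ℂ) : ℂ :=
  conj a / (‖a‖ : ℂ) * ((a - z) / (1 - conj a * z))

lemma one_sub_norm_le_norm_one_sub_conj_mul {a z : ℂ} (hz : ‖z‖ ≤ 1) :
    1 - ‖a‖ ≤ ‖1 - conj a * z‖ := by
  have h1 : ‖conj a * z‖ ≤ ‖a‖ := by
    rw [norm_mul, RCLike.norm_conj]
    exact mul_le_of_le_one_right (norm_nonneg _) hz
  have h2 := norm_sub_norm_le (1 : ℂ) (conj a * z)
  rw [norm_one] at h2
  linarith

lemma one_sub_norm_le_norm_one_sub_conj_mul' {a z : ℂ} (ha : ‖a‖ ≤ 1) :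
    1 - ‖z‖ ≤ ‖1 - conj a * z‖ := by
  have h1 : ‖conj a * z‖ ≤ ‖z‖ := by
    rw [norm_mul, RCLike.norm_conj]
    exact mul_le_of_le_one_left (norm_nonneg _) ha
  have h2 := norm_sub_norm_le (1 : ℂ) (conj a * z)
  rw [norm_one] at h2
  linarith

lemma one_sub_conj_mul_ne_zero {a z : ℂ} (ha : ‖a‖ < 1) (hz : ‖z‖ ≤ 1) :
    1 - conj a * z ≠ 0 := by
  rw [← norm_pos_iff]
  linarith [one_sub_norm_le_norm_one_sub_conj_mul (a := a) hz]

lemma norm_blaschkeFactor {a : ℂ} (ha : a ≠ 0) (z : ℂ) :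
    ‖blaschkeFactor a z‖ = ‖z - a‖ / ‖1 - conj a * z‖ := by
  have : ‖a‖ ≠ 0 := norm_ne_zero_iff.mpr ha
  rw [blaschkeFactor, norm_mul, norm_div, norm_div, RCLike.norm_conj, Complex.norm_real,
    norm_norm, div_self this, one_mul, norm_sub_rev]

lemma norm_one_sub_conj_mul_sq_sub (a z : ℂ) :
    ‖1 - conj a * z‖ ^ 2 - ‖z - a‖ ^ 2 = (1 - ‖a‖ ^ 2) * (1 - ‖z‖ ^ 2) := by
  simp only [← Complex.normSq_eq_norm_sq, Complex.normSq_apply, Complex.sub_re, Complex.sub_im,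
    Complex.mul_re, Complex.mul_im, Complex.conj_re, Complex.conj_im, Complex.one_re,
    Complex.one_im]
  ring

lemma norm_blaschkeFactor_le_one {a z : ℂ} (ha0 : a ≠ 0) (ha : ‖a‖ ≤ 1) (hz : ‖z‖ ≤ 1) :
    ‖blaschkeFactor a z‖ ≤ 1 := by
  rw [norm_blaschkeFactor ha0]
  refine div_le_one_of_le₀ ?_ (norm_nonneg _)
  have h := norm_one_sub_conj_mul_sq_sub a z
  have h1 : 0 ≤ (1 - ‖a‖ ^ 2) * (1 - ‖z‖ ^ 2) := by
    apply mul_nonneg <;> nlinarith [norm_nonneg a, norm_nonneg z]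
  exact le_of_sq_le_sq (by linarith) (norm_nonneg _)

/-- A single factor has modulus close to `1` near the unit circle. -/
lemma one_sub_norm_blaschkeFactor_le {a z : ℂ} (ha0 : a ≠ 0) (ha : ‖a‖ < 1) (hz : ‖z‖ ≤ 1) :
    1 - ‖blaschkeFactor a z‖ ≤ (1 - ‖z‖) * (4 / (1 - ‖a‖)) := by
  have h1 : 0 < 1 - ‖a‖ := by linarith
  have h2 := one_sub_norm_le_norm_one_sub_conj_mul (a := a) hz
  have h3 : 0 < ‖1 - conj a * z‖ := h1.trans_le h2
  have h4 := norm_blaschkeFactor_le_one ha0 ha.le hz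
  have h5 : 1 - ‖blaschkeFactor a z‖ ^ 2 =
      (1 - ‖a‖ ^ 2) * (1 - ‖z‖ ^ 2) / ‖1 - conj a * z‖ ^ 2 := by
    rw [norm_blaschkeFactor ha0, ← norm_one_sub_conj_mul_sq_sub, div_pow,
      sub_div, div_self (pow_ne_zero 2 h3.ne')]
  have h6 : (1 - ‖a‖ ^ 2) * (1 - ‖z‖ ^ 2) ≤ (1 - ‖a‖) * (1 - ‖z‖) * 4 := by
    have e : (1 - ‖a‖ ^ 2) * (1 - ‖z‖ ^ 2) =
      (1 - ‖a‖) * (1 - ‖z‖) * ((1 + ‖a‖) * (1 + ‖z‖)) := by ring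
    rw [e]
    apply mul_le_mul_of_nonneg_left _ (mul_nonneg h1.le (by linarith))
    nlinarith [norm_nonneg a, norm_nonneg z]
  have h8 : 0 ≤ (1 - ‖a‖) * (1 - ‖z‖) * 4 :=
    mul_nonneg (mul_nonneg h1.le (by linarith)) (by norm_num)
  calc 1 - ‖blaschkeFactor a z‖ ≤ 1 - ‖blaschkeFactor a z‖ ^ 2 := by
        nlinarith [norm_nonneg (blaschkeFactor a z)]
    _ ≤ (1 - ‖a‖) * (1 - ‖z‖) * 4 / (1 - ‖a‖) ^ 2 := by
        rw [h5]
        gcongr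
    _ = _ := by field_simp

lemma norm_blaschkeFactor_zero {a : ℂ} (ha : a ≠ 0) : ‖blaschkeFactor a 0‖ = ‖a‖ := by
  simp [norm_blaschkeFactor ha]

lemma differentiableAt_blaschkeFactor {a z : ℂ} (ha : ‖a‖ < 1) (hz : ‖z‖ ≤ 1) :
    DifferentiableAt ℂ (blaschkeFactor a) z := by
  unfold blaschkeFactor
  have := one_sub_conj_mul_ne_zero ha hz
  fun_prop (disch := assumption)

lemma norm_blaschkeFactor_sub_one_le {a z : ℂ} (ha0 : a ≠ 0) (ha : ‖a‖ < 1) (hz : ‖z‖ < 1) :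
    ‖blaschkeFactor a z - 1‖ ≤ (1 - ‖a‖) * (2 / (1 - ‖z‖)) := by
  have h1 := one_sub_conj_mul_ne_zero ha hz.le
  have h2 : (‖a‖ : ℂ) ≠ 0 := by exact_mod_cast norm_ne_zero_iff.mpr ha0
  have h3 : conj a * a = (‖a‖ : ℂ) ^ 2 := Complex.conj_mul' a
  have h4 : blaschkeFactor a z - 1 =
      -((1 - ‖a‖ : ℝ) : ℂ) * ((‖a‖ + conj a * z) / (‖a‖ * (1 - conj a * z))) := by
    rw [blaschkeFactor]
    field_simp
    push_cast
    linear_combination h3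
  have h5 : ‖(‖a‖ : ℂ) + conj a * z‖ ≤ 2 * ‖a‖ := by
    refine (norm_add_le _ _).trans ?_
    rw [norm_mul, RCLike.norm_conj, Complex.norm_real, norm_norm]
    nlinarith [norm_nonneg a]
  have h6 : 0 < ‖a‖ := norm_pos_iff.mpr ha0
  have h7 : 0 < 1 - ‖z‖ := by linarith
  rw [h4, norm_mul, norm_neg, Complex.norm_real, Real.norm_of_nonneg (by linarith), norm_div,
    norm_mul, Complex.norm_real, norm_norm]
  refine mul_le_mul_of_nonneg_left ?_ (by linarith)
  calc _ ≤ 2 * ‖a‖ / (‖a‖ * (1 - ‖z‖)) := by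
        gcongr
        exact one_sub_norm_le_norm_one_sub_conj_mul' ha.le
    _ = _ := by field_simp

/-- The Weierstrass product inequality. -/
lemma one_sub_sum_one_sub_le_prod {ι : Type*} {s : Finset ι} {x : ι → ℝ}
    (h0 : ∀ i ∈ s, 0 ≤ x i) (h1 : ∀ i ∈ s, x i ≤ 1) :
    1 - ∑ i ∈ s, (1 - x i) ≤ ∏ i ∈ s, x i := by
  classical
  induction s using Finset.induction_on with
  | empty => simp
  | insert i s hi ih =>
    have h3 := ih (fun j hj => h0 j (Finset.mem_insert_of_mem hj))
      fun j hj => h1 j (Finset.mem_insert_of_mem hj)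
    have h4 : ∏ n ∈ s, x n ≤ 1 :=
      Finset.prod_le_one (fun j hj => h0 j (Finset.mem_insert_of_mem hj))
        fun j hj => h1 j (Finset.mem_insert_of_mem hj)
    have h5 := h1 i (Finset.mem_insert_self i s)
    rw [Finset.sum_insert hi, Finset.prod_insert hi]
    nlinarith

namespace IsBlaschkeSequence

variable {a : ℕ → ℂ}

lemma ne_zero (ha : IsBlaschkeSequence a) (n : ℕ) : a n ≠ 0 := norm_pos_iff.mp (ha.norm_pos n)

lemma shift (ha : IsBlaschkeSequence a) (N : ℕ) : IsBlaschkeSequence fun n => a (n + N) :=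
  ⟨fun _ => ha.norm_pos _, fun _ => ha.norm_lt_one _, (summable_nat_add_iff N).mpr ha.summable⟩

lemma summable_norm_blaschkeFactor_sub_one (ha : IsBlaschkeSequence a) {z : ℂ} (hz : ‖z‖ < 1) :
    Summable fun n => ‖blaschkeFactor (a n) z - 1‖ :=
  (ha.summable.mul_right _).of_nonneg_of_le (fun _ => norm_nonneg _)
    fun n => norm_blaschkeFactor_sub_one_le (ha.ne_zero n) (ha.norm_lt_one n) hz

lemma multipliable (ha : IsBlaschkeSequence a) {z : ℂ} (hz : ‖z‖ < 1) :
    Multipliable fun n => blaschkeFactor (a n) z := by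
  simpa using multipliable_one_add_of_summable (ha.summable_norm_blaschkeFactor_sub_one hz)

lemma hasProd (ha : IsBlaschkeSequence a) {z : ℂ} (hz : ‖z‖ < 1) :
    HasProd (fun n => blaschkeFactor (a n) z) (blaschkeProduct a z) :=
  (ha.multipliable hz).hasProd

lemma differentiableOn_blaschkeProduct (ha : IsBlaschkeSequence a) :
    DifferentiableOn ℂ (blaschkeProduct a) (ball 0 1) := by
  have key : HasProdLocallyUniformlyOn (fun n z => blaschkeFactor (a n) z) (blaschkeProduct a)
      (ball 0 1) := by
    apply hasProdLocallyUniformlyOn_of_forall_compact isOpen_ball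
    intro K hK hcK
    rcases K.eq_empty_or_nonempty with rfl | hN
    · simpa [hasProdUniformlyOn_iff_tendstoUniformlyOn] using tendstoUniformlyOn_empty
    obtain ⟨z₀, hz₀, hmax⟩ := hcK.exists_isMaxOn hN (continuous_norm.continuousOn)
    have hlt : ∀ z ∈ K, ‖z‖ < 1 := fun z hz => by simpa using hK hz
    have := (ha.summable.mul_right (2 / (1 - ‖z₀‖))).hasProdUniformlyOn_nat_one_add
      (f := fun n z => blaschkeFactor (a n) z - 1) hcK (.of_forall fun n z hz => ?_)
      (fun n z hz => ?_)
    · simp only [add_sub_cancel] at this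
      exact this
    · refine (norm_blaschkeFactor_sub_one_le (ha.ne_zero n) (ha.norm_lt_one n) (hlt z hz)).trans ?_
      have h1 : ‖z‖ ≤ ‖z₀‖ := hmax hz
      have h2 := hlt z₀ hz₀
      have h3 := ha.norm_lt_one n
      have h4 : 0 < 1 - ‖z₀‖ := by linarith
      have h5 : 0 ≤ 1 - ‖a n‖ := by linarith
      gcongr
    · exact (((differentiableAt_blaschkeFactor (ha.norm_lt_one n)
        (hlt z hz).le).continuousAt).sub continuousAt_const).continuousWithinAt
  refine key.differentiableOn (.of_forall fun s => ?_) isOpen_ball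
  refine DifferentiableOn.fun_finsetProd fun n _ z hz => ?_
  exact (differentiableAt_blaschkeFactor (ha.norm_lt_one n)
    (by simpa using (mem_ball_zero_iff.mp hz).le)).differentiableWithinAt

lemma blaschkeProduct_eq_prod_mul (ha : IsBlaschkeSequence a) (N : ℕ) {z : ℂ} (hz : ‖z‖ < 1) :
    blaschkeProduct a z =
      (∏ i ∈ Finset.range N, blaschkeFactor (a i) z) *
        blaschkeProduct (fun n => a (n + N)) z :=
  (((ha.shift N).multipliable hz).prod_mul_tprod_nat_mul'
    (f := fun n => blaschkeFactor (a n) z)).symm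

lemma norm_blaschkeProduct_le_factor (ha : IsBlaschkeSequence a) (n : ℕ) {z : ℂ} (hz : ‖z‖ < 1) :
    ‖blaschkeProduct a z‖ ≤ ‖blaschkeFactor (a n) z‖ := by
  refine le_of_tendsto (ha.hasProd hz).norm ?_
  filter_upwards [eventually_ge_atTop {n}] with s hs
  rw [← Finset.mul_prod_erase s _ (hs (Finset.mem_singleton_self n))]
  refine mul_le_of_le_one_right (norm_nonneg _) (Finset.prod_le_one (fun _ _ => norm_nonneg _)
    fun i _ => norm_blaschkeFactor_le_one (ha.ne_zero i) (ha.norm_lt_one i).le hz.le)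

lemma norm_blaschkeProduct_le_one (ha : IsBlaschkeSequence a) {z : ℂ} (hz : ‖z‖ < 1) :
    ‖blaschkeProduct a z‖ ≤ 1 :=
  (ha.norm_blaschkeProduct_le_factor 0 hz).trans
    (norm_blaschkeFactor_le_one (ha.ne_zero 0) (ha.norm_lt_one 0).le hz.le)

lemma one_sub_tsum_le_norm_blaschkeProduct_zero (ha : IsBlaschkeSequence a) :
    1 - ∑' n, (1 - ‖a n‖) ≤ ‖blaschkeProduct a 0‖ := by
  refine ge_of_tendsto (ha.hasProd (by simp)).norm (.of_forall fun s => ?_)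
  have h1 : ∑ n ∈ s, (1 - ‖a n‖) ≤ ∑' n, (1 - ‖a n‖) :=
    ha.summable.sum_le_tsum _ fun i _ => by linarith [ha.norm_lt_one i]
  have h2 := one_sub_sum_one_sub_le_prod (s := s) (x := fun n => ‖a n‖)
    (fun _ _ => norm_nonneg _) fun i _ => (ha.norm_lt_one i).le
  have h3 : ∏ n ∈ s, ‖blaschkeFactor (a n) 0‖ = ∏ n ∈ s, ‖a n‖ :=
    Finset.prod_congr rfl fun i _ => norm_blaschkeFactor_zero (ha.ne_zero i)
  exact h3 ▸ by linarith

/-- Cauchy's estimate; up to the constant this is the Schwarz–Pick bound. -/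
lemma norm_deriv_blaschkeProduct_le (ha : IsBlaschkeSequence a) {z : ℂ} (hz : ‖z‖ < 1) :
    ‖deriv (blaschkeProduct a) z‖ ≤ 2 / (1 - ‖z‖) := by
  have h0 : 0 < (1 - ‖z‖) / 2 := by linarith
  have hsub : closedBall z ((1 - ‖z‖) / 2) ⊆ ball 0 1 := by
    intro w hw
    rw [mem_closedBall, dist_eq_norm] at hw
    rw [mem_ball_zero_iff]
    linarith [norm_sub_norm_le w z]
  have h := Complex.norm_deriv_le_of_forall_mem_sphere_norm_le h0
    ((ha.differentiableOn_blaschkeProduct.mono hsub).diffContOnCl_ball subset_rfl)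
    (fun w hw => ha.norm_blaschkeProduct_le_one
      (mem_ball_zero_iff.mp (hsub (sphere_subset_closedBall hw))))
  rwa [one_div_div] at h

end IsBlaschkeSequence

/-! ### Boundary behaviour in the mean -/

lemma norm_circleMap_zero_lt_one {r : ℝ} (h0 : 0 ≤ r) (h1 : r < 1) (θ : ℝ) :
    ‖circleMap 0 r θ‖ < 1 := by
  rwa [norm_circleMap_zero, abs_of_nonneg h0]

lemma continuous_comp_circleMap {F : ℂ → ℂ} (hF : ContinuousOn F (ball 0 1)) {r : ℝ} (h0 : 0 ≤ r)
    (h1 : r < 1) : Continuous fun θ => F (circleMap 0 r θ) :=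
  hF.comp_continuous (continuous_circleMap 0 r)
    fun θ => mem_ball_zero_iff.mpr (norm_circleMap_zero_lt_one h0 h1 θ)

/-- The mean value property, as an upper bound for the mean of `1 - |F|` on a circle. -/
lemma integral_one_sub_norm_circleMap_le {F : ℂ → ℂ} (hF : DifferentiableOn ℂ F (ball 0 1)) {r : ℝ}
    (h0 : 0 ≤ r) (h1 : r < 1) :
    ∫ θ in -π..π, (1 - ‖F (circleMap 0 r θ)‖) ≤ 2 * π * (1 - ‖F 0‖) := by
  have hc := continuous_comp_circleMap hF.continuousOn h0 h1
  have hsub : closedBall (0 : ℂ) |r| ⊆ ball 0 1 :=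
    closedBall_subset_ball (by rwa [abs_of_nonneg h0])
  have hm : Real.circleAverage F 0 r = F 0 :=
    ((hF.mono hsub).diffContOnCl_ball subset_rfl).circleAverage
  have hm2 : ∫ θ in -π..π, F (circleMap 0 r θ) = 2 * π * F 0 := by
    have hper : Function.Periodic (fun θ => F (circleMap 0 r θ)) (2 * π) := fun θ => by
      simp only [periodic_circleMap 0 r θ]
    have := hper.intervalIntegral_add_eq (-π) 0
    rw [show -π + 2 * π = π by ring, zero_add] at this
    rw [this, ← hm, Real.circleAverage_def, Complex.real_smul]
    push_cast
    field_simp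
  have h2 : ‖∫ θ in -π..π, F (circleMap 0 r θ)‖ ≤ ∫ θ in -π..π, ‖F (circleMap 0 r θ)‖ :=
    intervalIntegral.norm_integral_le_integral_norm (by linarith [Real.pi_pos])
  rw [hm2, norm_mul, norm_mul, Complex.norm_real, Complex.norm_ofNat,
    Real.norm_of_nonneg Real.pi_pos.le] at h2
  rw [intervalIntegral.integral_sub (by simp) (hc.norm.intervalIntegrable _ _)]
  simp only [intervalIntegral.integral_const, smul_eq_mul]
  linarith

lemma lintegral_Ioo_ofReal_eq {g : ℝ → ℝ} (hg : Continuous g) (h : ∀ θ, 0 ≤ g θ) :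
    ∫⁻ θ in Ioo (-π) π, ENNReal.ofReal (g θ) = ENNReal.ofReal (∫ θ in -π..π, g θ) := by
  have hi : IntegrableOn g (Ioc (-π) π) := hg.integrableOn_Ioc
  rw [intervalIntegral.integral_of_le (by linarith [Real.pi_pos]),
    ofReal_integral_eq_lintegral_ofReal hi (.of_forall h), restrict_Ioo_eq_restrict_Ioc]

namespace IsBlaschkeSequence

variable {a : ℕ → ℂ}

/-- Off a finite number of factors a Blaschke product is close to `1` in mean, and a finite
Blaschke product is uniformly close to `1` in modulus near the unit circle. -/
lemma integral_one_sub_norm_blaschkeProduct_le (ha : IsBlaschkeSequence a) (N : ℕ) {r : ℝ}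
    (h0 : 0 ≤ r) (h1 : r < 1) :
    ∫ θ in -π..π, (1 - ‖blaschkeProduct a (circleMap 0 r θ)‖) ≤
      2 * π * ((1 - r) * ∑ i ∈ Finset.range N, 4 / (1 - ‖a i‖) + ∑' n, (1 - ‖a (n + N)‖)) := by
  set C := ∑ i ∈ Finset.range N, 4 / (1 - ‖a i‖)
  have hR := ha.shift N
  have hcB := continuous_comp_circleMap ha.differentiableOn_blaschkeProduct.continuousOn h0 h1
  have hcR := continuous_comp_circleMap hR.differentiableOn_blaschkeProduct.continuousOn h0 h1
  have hC : 0 ≤ C := Finset.sum_nonneg fun i _ => div_nonneg (by norm_num)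
    (by linarith [ha.norm_lt_one i])
  have hpt : ∀ θ, 1 - ‖blaschkeProduct a (circleMap 0 r θ)‖ ≤
      (1 - r) * C + (1 - ‖blaschkeProduct (fun n => a (n + N)) (circleMap 0 r θ)‖) := by
    intro θ
    have hz := norm_circleMap_zero_lt_one h0 h1 θ
    have hzr : ‖circleMap 0 r θ‖ = r := by rw [norm_circleMap_zero, abs_of_nonneg h0]
    set z := circleMap 0 r θ
    have hP : 1 - (1 - r) * C ≤ ∏ i ∈ Finset.range N, ‖blaschkeFactor (a i) z‖ := by
      refine le_trans ?_ (one_sub_sum_one_sub_le_prod (fun _ _ => norm_nonneg _)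
        fun i _ => norm_blaschkeFactor_le_one (ha.ne_zero i) (ha.norm_lt_one i).le hz.le)
      rw [Finset.mul_sum]
      refine sub_le_sub_left (Finset.sum_le_sum fun i _ => ?_) _
      have := one_sub_norm_blaschkeFactor_le (ha.ne_zero i) (ha.norm_lt_one i) hz.le
      rwa [hzr] at this
    rw [ha.blaschkeProduct_eq_prod_mul N hz, norm_mul, norm_prod]
    have hx : 0 ≤ (1 - r) * C := mul_nonneg (by linarith) hC
    have hR1 := hR.norm_blaschkeProduct_le_one hz
    have hR0 := norm_nonneg (blaschkeProduct (fun n => a (n + N)) z)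
    nlinarith [mul_le_mul_of_nonneg_right hP hR0]
  calc _ ≤ ∫ θ in -π..π, ((1 - r) * C +
        (1 - ‖blaschkeProduct (fun n => a (n + N)) (circleMap 0 r θ)‖)) :=
        intervalIntegral.integral_mono_on (by linarith [Real.pi_pos])
          ((continuous_const.sub hcB.norm).intervalIntegrable _ _)
          ((continuous_const.add (continuous_const.sub hcR.norm)).intervalIntegrable _ _)
          fun θ _ => hpt θ
    _ = 2 * π * ((1 - r) * C) +
        ∫ θ in -π..π, (1 - ‖blaschkeProduct (fun n => a (n + N)) (circleMap 0 r θ)‖) := by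
        rw [intervalIntegral.integral_add (by simp)
          (Continuous.intervalIntegrable (by fun_prop) _ _)]
        simp only [intervalIntegral.integral_const, smul_eq_mul]
        ring
    _ ≤ _ := by
        have h2 := integral_one_sub_norm_circleMap_le hR.differentiableOn_blaschkeProduct h0 h1
        have h3 := hR.one_sub_tsum_le_norm_blaschkeProduct_zero
        nlinarith [Real.pi_pos]

/-- A Blaschke product is inner, in the form that its modulus tends to `1` in mean at the
boundary. -/
lemma tendsto_lintegral_one_sub_norm_blaschkeProduct (ha : IsBlaschkeSequence a) :
    Tendsto (fun r => ∫⁻ θ in Ioo (-π) π,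
      ENNReal.ofReal (1 - ‖blaschkeProduct a (circleMap 0 r θ)‖)) (𝓝[<] 1) (𝓝 0) := by
  have hmem : Ioo (0 : ℝ) 1 ∈ 𝓝[<] (1 : ℝ) := Ioo_mem_nhdsLT one_pos
  have key : Tendsto (fun r => ∫ θ in -π..π, (1 - ‖blaschkeProduct a (circleMap 0 r θ)‖))
      (𝓝[<] 1) (𝓝 0) := by
    rw [tendsto_order]
    constructor
    · intro b hb
      filter_upwards [hmem] with r hr
      refine hb.trans_le
        (intervalIntegral.integral_nonneg (by linarith [Real.pi_pos]) fun θ _ => ?_)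
      linarith [ha.norm_blaschkeProduct_le_one (norm_circleMap_zero_lt_one hr.1.le hr.2 θ)]
    · intro ε hε
      have hT : Tendsto (fun N => 2 * π * (0 + ∑' n, (1 - ‖a (n + N)‖))) atTop (𝓝 0) := by
        have := (tendsto_sum_nat_add fun n => 1 - ‖a n‖).const_mul (2 * π)
        simpa using this
      obtain ⟨N, hN⟩ := (hT.eventually_lt_const hε).exists
      have hr : Tendsto (fun r : ℝ => 2 * π * ((1 - r) * ∑ i ∈ Finset.range N, 4 / (1 - ‖a i‖) +
          ∑' n, (1 - ‖a (n + N)‖))) (𝓝[<] 1) (𝓝 (2 * π * (0 + ∑' n, (1 - ‖a (n + N)‖)))) := by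
        refine tendsto_nhdsWithin_of_tendsto_nhds (Continuous.tendsto' (by fun_prop) _ _ ?_)
        simp
      filter_upwards [hr.eventually_lt_const hN, hmem] with r h1 h2
      exact (ha.integral_one_sub_norm_blaschkeProduct_le N h2.1.le h2.2).trans_lt h1
  have h2 := ENNReal.tendsto_ofReal key
  rw [ENNReal.ofReal_zero] at h2
  refine h2.congr' ?_
  filter_upwards [hmem] with r hr
  refine (lintegral_Ioo_ofReal_eq (g := fun θ => 1 - ‖blaschkeProduct a (circleMap 0 r θ)‖)
    (continuous_const.sub (continuous_comp_circleMap
    ha.differentiableOn_blaschkeProduct.continuousOn hr.1.le hr.2).norm) fun θ => ?_).symm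
  linarith [ha.norm_blaschkeProduct_le_one (norm_circleMap_zero_lt_one hr.1.le hr.2 θ)]

end IsBlaschkeSequence

/-- Integration of `F'` along a radius. -/
lemma enorm_sub_radius_le_lintegral {F : ℂ → ℂ} (hF : DifferentiableOn ℂ F (ball 0 1)) {r R : ℝ}
    (h0 : 0 ≤ r) (hrR : r ≤ R) (hR : R < 1) (θ : ℝ) :
    ‖F (circleMap 0 R θ) - F (circleMap 0 r θ)‖ₑ ≤
      ∫⁻ ρ in Ioo r 1, ‖deriv F (circleMap 0 ρ θ)‖ₑ := by
  have hd : ∀ ρ ∈ Icc r R, HasDerivAt (fun ρ : ℝ => F (circleMap 0 ρ θ))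
      (deriv F (circleMap 0 ρ θ) * Complex.exp (θ * Complex.I)) ρ := by
    intro ρ hρ
    have h1 : HasDerivAt F (deriv F (circleMap 0 ρ θ)) (circleMap 0 ρ θ) :=
      (hF.differentiableAt (isOpen_ball.mem_nhds (mem_ball_zero_iff.mpr
        (norm_circleMap_zero_lt_one (h0.trans hρ.1) (hρ.2.trans_lt hR) θ)))).hasDerivAt
    have h2 : HasDerivAt (fun ρ : ℝ => circleMap 0 ρ θ) (Complex.exp (θ * Complex.I)) ρ := by
      simpa [circleMap] using (Complex.ofRealCLM.hasDerivAt (x := ρ)).mul_const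
        (Complex.exp (θ * Complex.I))
    exact h1.comp ρ h2
  have hC : ContDiffOn ℝ 1 (fun ρ : ℝ => F (circleMap 0 ρ θ)) (Icc r R) := by
    have h1 : ContDiffOn ℝ 1 F (ball 0 1) := (hF.contDiffOn isOpen_ball).restrict_scalars ℝ
    refine h1.comp (g := F) (f := fun ρ : ℝ => circleMap 0 ρ θ) ?_ ?_
    · exact (contDiff_const.add
        (Complex.ofRealCLM.contDiff.mul contDiff_const)).contDiffOn
    · exact fun ρ hρ => mem_ball_zero_iff.mpr
        (norm_circleMap_zero_lt_one (h0.trans hρ.1) (hρ.2.trans_lt hR) θ)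
  refine (enorm_sub_le_lintegral_deriv_of_contDiffOn_Icc hC hrR).trans ?_
  calc _ = ∫⁻ ρ in Icc r R, ‖deriv F (circleMap 0 ρ θ)‖ₑ := by
        refine setLIntegral_congr_fun measurableSet_Icc fun ρ hρ => ?_
        simp only [(hd ρ hρ).deriv, enorm_mul]
        rw [← ofReal_norm (Complex.exp _), Complex.norm_exp_ofReal_mul_I]
        simp
    _ = ∫⁻ ρ in Ioo r R, ‖deriv F (circleMap 0 ρ θ)‖ₑ := by rw [restrict_Ioo_eq_restrict_Icc]
    _ ≤ _ := lintegral_mono_set (Ioo_subset_Ioo_right hR.le)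

/-- If the positive part of `1 - |F|` tends to `0` in mean at the boundary, then on each circle it is
controlled, in `L^q`, by the radial integrals of `|F'|` out to the boundary. Radial limits almost
everywhere are not needed. -/
lemma lintegral_one_sub_norm_rpow_le {F : ℂ → ℂ} (hF : DifferentiableOn ℂ F (ball 0 1))
    (hlim : Tendsto (fun r => ∫⁻ θ in Ioo (-π) π, ENNReal.ofReal (1 - ‖F (circleMap 0 r θ)‖))
      (𝓝[<] 1) (𝓝 0)) {q : ℝ} (hq : 1 ≤ q) {r : ℝ} (h0 : 0 ≤ r) (h1 : r < 1) :
    ∫⁻ θ in Ioo (-π) π, ENNReal.ofReal (1 - ‖F (circleMap 0 r θ)‖) ^ q ≤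
      2 ^ (q - 1) * ∫⁻ θ in Ioo (-π) π,
        (∫⁻ ρ in Ioo r 1, ‖deriv F (circleMap 0 ρ θ)‖ₑ) ^ q := by
  set H : ℝ → ℝ≥0∞ := fun θ => ∫⁻ ρ in Ioo r 1, ‖deriv F (circleMap 0 ρ θ)‖ₑ
  have hlim2 : Tendsto (fun R => (2 : ℝ≥0∞) ^ (q - 1) *
      ((∫⁻ θ in Ioo (-π) π, ENNReal.ofReal (1 - ‖F (circleMap 0 R θ)‖)) +
        ∫⁻ θ in Ioo (-π) π, H θ ^ q)) (𝓝[<] 1)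
      (𝓝 (2 ^ (q - 1) * (0 + ∫⁻ θ in Ioo (-π) π, H θ ^ q))) := by
    refine ENNReal.Tendsto.const_mul (hlim.add tendsto_const_nhds) (.inr ?_)
    exact ENNReal.rpow_ne_top_of_nonneg (by linarith) (by simp)
  rw [zero_add] at hlim2
  -- Compare radius `r` with a radius `R` close to `1`, where `1 - |F|` is small in mean.
  refine ge_of_tendsto hlim2 ?_
  filter_upwards [Ioo_mem_nhdsLT h1] with R hR
  have hcR := continuous_comp_circleMap hF.continuousOn (h0.trans hR.1.le) hR.2
  have hmeas : Measurable fun θ => ENNReal.ofReal (1 - ‖F (circleMap 0 R θ)‖) :=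
    (continuous_const.sub hcR.norm).measurable.ennreal_ofReal
  rw [← lintegral_add_left hmeas, ← lintegral_const_mul' _ _
    (ENNReal.rpow_ne_top_of_nonneg (by linarith) (by simp))]
  refine lintegral_mono fun θ => ?_
  have hle : ENNReal.ofReal (1 - ‖F (circleMap 0 r θ)‖) ≤
      ENNReal.ofReal (1 - ‖F (circleMap 0 R θ)‖) + H θ := by
    refine le_trans ?_ (add_le_add_right (enorm_sub_radius_le_lintegral hF h0 hR.1.le hR.2 θ) _)
    rw [← ofReal_norm]
    refine le_trans (ENNReal.ofReal_le_ofReal ?_) ENNReal.ofReal_add_le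
    linarith [norm_sub_norm_le (F (circleMap 0 R θ)) (F (circleMap 0 r θ))]
  calc _ ≤ (ENNReal.ofReal (1 - ‖F (circleMap 0 R θ)‖) + H θ) ^ q :=
        ENNReal.rpow_le_rpow hle (by linarith)
    _ ≤ 2 ^ (q - 1) * (ENNReal.ofReal (1 - ‖F (circleMap 0 R θ)‖) ^ q + H θ ^ q) :=
        ENNReal.rpow_add_le_mul_rpow_add_rpow _ _ hq
    _ ≤ _ := by
        gcongr
        exact ENNReal.rpow_le_self_of_le_one (by simp) hq

/-! ### Hardy's inequality with radial weights -/

lemma lintegral_Ioo_one_sub_rpow {e a : ℝ} (he : -1 < e) (ha : a ≤ 1) :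
    ∫⁻ r in Ioo a 1, ENNReal.ofReal ((1 - r) ^ e) =
      ENNReal.ofReal ((1 - a) ^ (e + 1) / (e + 1)) := by
  have h1 : ∫ r in a..1, (1 - r) ^ e = (1 - a) ^ (e + 1) / (e + 1) := by
    rw [intervalIntegral.integral_comp_sub_left (fun x => x ^ e), sub_self,
      integral_rpow (.inl he), Real.zero_rpow (by linarith), sub_zero]
  have h2 : IntervalIntegrable (fun r : ℝ => (1 - r) ^ e) volume a 1 := by
    have := (intervalIntegral.intervalIntegrable_rpow' (a := 1 - a) (b := 1 - 1) he).comp_sub_left 1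
    simpa using this
  rw [← h1, intervalIntegral.integral_of_le ha, ofReal_integral_eq_lintegral_ofReal
    ((intervalIntegrable_iff_integrableOn_Ioc_of_le ha).mp h2), restrict_Ioo_eq_restrict_Ioc]
  filter_upwards [ae_restrict_mem measurableSet_Ioc] with r hr
  exact Real.rpow_nonneg (by linarith [hr.2]) _

lemma lintegral_Ioo_zero_one_sub_rpow_le {e b : ℝ} (he : e < -1) (h0 : 0 ≤ b) (hb : b < 1) :
    ∫⁻ r in Ioo 0 b, ENNReal.ofReal ((1 - r) ^ e) ≤
      ENNReal.ofReal ((1 - b) ^ (e + 1) / (-(e + 1))) := by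
  have hmem : (0 : ℝ) ∉ uIcc (1 - b) 1 := by
    rw [uIcc_of_le (by linarith)]
    exact fun h => by linarith [h.1]
  have h1 : ∫ r in (0 : ℝ)..b, (1 - r) ^ e = (1 - (1 - b) ^ (e + 1)) / (e + 1) := by
    rw [intervalIntegral.integral_comp_sub_left (fun x => x ^ e), sub_zero,
      integral_rpow (.inr ⟨he.ne, hmem⟩), Real.one_rpow]
  have h2 : IntervalIntegrable (fun r : ℝ => (1 - r) ^ e) volume 0 b := by
    refine ContinuousOn.intervalIntegrable ?_
    rw [uIcc_of_le h0]
    exact (continuousOn_const.sub continuousOn_id).rpow_const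
      fun r hr => .inl (sub_pos.mpr (hr.2.trans_lt hb)).ne'
  have h3 : ∫⁻ r in Ioo 0 b, ENNReal.ofReal ((1 - r) ^ e) =
      ENNReal.ofReal ((1 - (1 - b) ^ (e + 1)) / (e + 1)) := by
    rw [← h1, intervalIntegral.integral_of_le h0, ofReal_integral_eq_lintegral_ofReal
      ((intervalIntegrable_iff_integrableOn_Ioc_of_le h0).mp h2), restrict_Ioo_eq_restrict_Ioc]
    filter_upwards [ae_restrict_mem measurableSet_Ioc] with r hr
    exact Real.rpow_nonneg (by linarith [hr.2]) _
  rw [h3]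
  refine ENNReal.ofReal_le_ofReal ?_
  rw [← neg_div_neg_eq]
  exact div_le_div_of_nonneg_right (by linarith) (by linarith)

/-- Hölder's inequality for `f = ((1 - ρ) ^ (γ / q) f) · (1 - ρ) ^ (-γ / q)`; the second factor is
integrable to the conjugate power up to the boundary because `γ < q - 1`. -/
lemma lintegral_rpow_le_weighted {q γ : ℝ} (hq : 1 < q) (hγ : γ < q - 1) {f : ℝ → ℝ≥0∞}
    (hf : Measurable f) {r : ℝ} (hr : r < 1) :
    (∫⁻ ρ in Ioo r 1, f ρ) ^ q ≤
      ENNReal.ofReal ((1 - γ / (q - 1)) ^ (-(q - 1))) * ENNReal.ofReal ((1 - r) ^ (q - 1 - γ)) *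
        ∫⁻ ρ in Ioo r 1, ENNReal.ofReal ((1 - ρ) ^ γ) * f ρ ^ q := by
  have hq1 : 0 < q - 1 := by linarith
  have hq0 : 0 < q := by linarith
  have hk : 0 < 1 - γ / (q - 1) := by rw [sub_pos, div_lt_one hq1]; exact hγ
  have hr' : 0 < 1 - r := by linarith
  set u : ℝ → ℝ≥0∞ := fun ρ => ENNReal.ofReal ((1 - ρ) ^ (γ / q)) * f ρ
  set v : ℝ → ℝ≥0∞ := fun ρ => ENNReal.ofReal ((1 - ρ) ^ (-(γ / q)))
  have hmw : ∀ e : ℝ, Measurable fun ρ : ℝ => ENNReal.ofReal ((1 - ρ) ^ e) := fun e =>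
    ((measurable_const.sub measurable_id).pow_const e).ennreal_ofReal
  have hconj : q.HolderConjugate (q / (q - 1)) := Real.HolderConjugate.conjExponent hq
  have e1 : ∫⁻ ρ in Ioo r 1, f ρ = ∫⁻ ρ in Ioo r 1, (u * v) ρ := by
    refine setLIntegral_congr_fun measurableSet_Ioo fun ρ hρ => ?_
    have h1 : 0 < 1 - ρ := by linarith [hρ.2]
    simp only [u, v, Pi.mul_apply]
    rw [mul_right_comm, ← ENNReal.ofReal_mul (by positivity), ← Real.rpow_add h1]
    simp
  have e2 : ∫⁻ ρ in Ioo r 1, u ρ ^ q =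
      ∫⁻ ρ in Ioo r 1, ENNReal.ofReal ((1 - ρ) ^ γ) * f ρ ^ q := by
    refine setLIntegral_congr_fun measurableSet_Ioo fun ρ hρ => ?_
    have h1 : 0 < 1 - ρ := by linarith [hρ.2]
    simp only [u]
    rw [ENNReal.mul_rpow_of_nonneg _ _ hq0.le, ENNReal.ofReal_rpow_of_nonneg (by positivity) hq0.le,
      ← Real.rpow_mul h1.le, div_mul_cancel₀ _ hq0.ne']
  have e3 : ∫⁻ ρ in Ioo r 1, v ρ ^ (q / (q - 1)) =
      ENNReal.ofReal ((1 - r) ^ (1 - γ / (q - 1)) / (1 - γ / (q - 1))) := by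
    rw [show 1 - γ / (q - 1) = -(γ / (q - 1)) + 1 by ring,
      ← lintegral_Ioo_one_sub_rpow (by linarith) hr.le]
    refine setLIntegral_congr_fun measurableSet_Ioo fun ρ hρ => ?_
    have h1 : 0 < 1 - ρ := by linarith [hρ.2]
    simp only [v]
    rw [ENNReal.ofReal_rpow_of_nonneg (by positivity) (by positivity), ← Real.rpow_mul h1.le]
    congr 2
    field_simp
  have hH := ENNReal.lintegral_mul_le_Lp_mul_Lq (volume.restrict (Ioo r 1)) hconj
    (f := u) (g := v) ((hmw _).mul hf).aemeasurable (hmw _).aemeasurable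
  rw [← e1, e2, e3] at hH
  refine (ENNReal.rpow_le_rpow hH hq0.le).trans (le_of_eq ?_)
  rw [ENNReal.mul_rpow_of_nonneg _ _ hq0.le, ← ENNReal.rpow_mul, one_div_mul_cancel hq0.ne',
    ENNReal.rpow_one, ← ENNReal.rpow_mul, mul_comm]
  congr 1
  rw [show 1 / (q / (q - 1)) * q = q - 1 by field_simp,
    ENNReal.ofReal_rpow_of_nonneg (by positivity) hq1.le, ← ENNReal.ofReal_mul (by positivity),
    div_eq_mul_inv, Real.mul_rpow (by positivity) (by positivity), ← Real.rpow_mul hr'.le,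
    Real.inv_rpow hk.le, ← Real.rpow_neg hk.le, mul_comm]
  congr 3
  field_simp

/-- Hardy's inequality at the boundary of the disc, in polar coordinates: the weight `r` is the
Jacobian. -/
lemma hardy_lintegral_le {q β : ℝ} (hq : 1 < q) (hβ : β < q - 1) :
    ∃ C : ℝ≥0∞, C ≠ ∞ ∧ ∀ f : ℝ → ℝ≥0∞, Measurable f →
      ∫⁻ r in Ioo 0 1, ENNReal.ofReal (r * (1 - r) ^ (β - q)) * (∫⁻ ρ in Ioo r 1, f ρ) ^ q ≤
        C * ∫⁻ ρ in Ioo 0 1, ENNReal.ofReal (ρ * (1 - ρ) ^ β) * f ρ ^ q := by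
  -- Any exponent strictly between `β` and `q - 1` makes both one-dimensional integrals converge.
  obtain ⟨γ, hβγ, hγ⟩ := exists_between hβ
  set K := ENNReal.ofReal ((1 - γ / (q - 1)) ^ (-(q - 1)))
  refine ⟨K * ENNReal.ofReal (1 / (γ - β)), ENNReal.mul_ne_top (by simp [K]) (by simp),
    fun f hf => ?_⟩
  have hmw : ∀ e : ℝ, Measurable fun ρ : ℝ => ENNReal.ofReal ((1 - ρ) ^ e) := fun e =>
    ((measurable_const.sub measurable_id).pow_const e).ennreal_ofReal
  set g : ℝ → ℝ≥0∞ := fun ρ => ENNReal.ofReal (ρ * (1 - ρ) ^ γ) * f ρ ^ q with hg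
  have hgm : Measurable g := ((measurable_id.mul
    ((measurable_const.sub measurable_id).pow_const γ)).ennreal_ofReal).mul (hf.pow_const q)
  set w : ℝ → ℝ≥0∞ := fun r => ENNReal.ofReal ((1 - r) ^ (β - γ - 1)) with hw
  have step1 : ∀ r ∈ Ioo (0 : ℝ) 1,
      ENNReal.ofReal (r * (1 - r) ^ (β - q)) * (∫⁻ ρ in Ioo r 1, f ρ) ^ q ≤
        K * ∫⁻ ρ in Ioo 0 1, (Ioi r).indicator (fun ρ => w r * g ρ) ρ := by
    intro r hr
    have h1 : 0 < 1 - r := by linarith [hr.2]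
    rw [setLIntegral_indicator measurableSet_Ioi, show Ioi r ∩ Ioo 0 1 = Ioo r 1 by
      ext x; simp only [mem_inter_iff, mem_Ioi, mem_Ioo]
      exact ⟨fun h => ⟨h.1, h.2.2⟩, fun h => ⟨h.1, hr.1.trans h.1, h.2⟩⟩]
    calc _ ≤ ENNReal.ofReal (r * (1 - r) ^ (β - q)) * (K * ENNReal.ofReal ((1 - r) ^ (q - 1 - γ)) *
          ∫⁻ ρ in Ioo r 1, ENNReal.ofReal ((1 - ρ) ^ γ) * f ρ ^ q) := by
          gcongr
          exact lintegral_rpow_le_weighted hq hγ hf hr.2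
      _ = K * ∫⁻ ρ in Ioo r 1, w r * (ENNReal.ofReal r *
          (ENNReal.ofReal ((1 - ρ) ^ γ) * f ρ ^ q)) := by
          rw [lintegral_const_mul' _ _ (by simp [w]), lintegral_const_mul' _ _ (by simp),
            ENNReal.ofReal_mul hr.1.le]
          have : w r = ENNReal.ofReal ((1 - r) ^ (β - q)) *
              ENNReal.ofReal ((1 - r) ^ (q - 1 - γ)) := by
            rw [← ENNReal.ofReal_mul (by positivity), ← Real.rpow_add h1, hw]
            simp only
            congr 2
            ring
          rw [this]
          ring
      _ ≤ _ := by
          -- On the range of integration `r < ρ`, so the Jacobian factor may be moved to `ρ`.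
          refine mul_le_mul_right (setLIntegral_mono' measurableSet_Ioo fun ρ hρ => ?_) _
          refine mul_le_mul_right ?_ _
          rw [hg]
          simp only
          rw [ENNReal.ofReal_mul (hr.1.trans hρ.1).le, mul_assoc]
          gcongr
          exact hρ.1.le
  have step2 : ∀ ρ ∈ Ioo (0 : ℝ) 1,
      ∫⁻ r in Ioo 0 1, (Ioi r).indicator (fun ρ => w r * g ρ) ρ ≤
        ENNReal.ofReal (1 / (γ - β)) * (ENNReal.ofReal (ρ * (1 - ρ) ^ β) * f ρ ^ q) := by
    intro ρ hρ
    have h1 : 0 < 1 - ρ := by linarith [hρ.2]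
    have e1 : ∀ r, (Ioi r).indicator (fun ρ => w r * g ρ) ρ =
        (Iio ρ).indicator (fun r => w r * g ρ) r := by
      intro r
      simp [indicator_apply]
    simp only [e1]
    rw [setLIntegral_indicator measurableSet_Iio, show Iio ρ ∩ Ioo 0 1 = Ioo 0 ρ by
      ext x; simp only [mem_inter_iff, mem_Iio, mem_Ioo]
      exact ⟨fun h => ⟨h.2.1, h.1⟩, fun h => ⟨h.2, h.1, h.2.trans hρ.2⟩⟩,
      lintegral_mul_const _ (hmw _)]
    calc _ ≤ ENNReal.ofReal ((1 - ρ) ^ (β - γ - 1 + 1) / (-(β - γ - 1 + 1))) * g ρ := by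
          gcongr
          exact lintegral_Ioo_zero_one_sub_rpow_le (by linarith) hρ.1.le hρ.2
      _ = _ := by
          rw [hg]
          simp only
          rw [← mul_assoc, ← mul_assoc, ← ENNReal.ofReal_mul
            (div_nonneg (by positivity) (by linarith)), ← ENNReal.ofReal_mul
            (div_nonneg zero_le_one (by linarith))]
          congr 2
          have : (1 - ρ) ^ β = (1 - ρ) ^ (β - γ) * (1 - ρ) ^ γ := by
            rw [← Real.rpow_add h1]; congr 1; ring
          rw [this, show β - γ - 1 + 1 = β - γ by ring, neg_sub]
          ring
  calc _ ≤ ∫⁻ r in Ioo 0 1, K * ∫⁻ ρ in Ioo 0 1, (Ioi r).indicator (fun ρ => w r * g ρ) ρ :=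
        setLIntegral_mono' measurableSet_Ioo step1
    _ = K * ∫⁻ ρ in Ioo 0 1, ∫⁻ r in Ioo 0 1, (Ioi r).indicator (fun ρ => w r * g ρ) ρ := by
        rw [lintegral_const_mul' _ _ (by simp [K]), lintegral_lintegral_swap]
        have hm : Measurable fun x : ℝ × ℝ => w x.1 * g x.2 :=
          ((hmw _).comp measurable_fst).mul (hgm.comp measurable_snd)
        exact (hm.indicator (measurableSet_lt measurable_fst measurable_snd)).aemeasurable
    _ ≤ K * ∫⁻ ρ in Ioo 0 1, ENNReal.ofReal (1 / (γ - β)) *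
          (ENNReal.ofReal (ρ * (1 - ρ) ^ β) * f ρ ^ q) :=
        mul_le_mul_right (setLIntegral_mono' measurableSet_Ioo step2) _
    _ = _ := by rw [lintegral_const_mul' _ _ (by simp), mul_assoc]

/-! ### Area integrals and separated zeros -/

lemma lintegral_unitBall_eq_polar (G : ℂ → ℝ≥0∞) :
    ∫⁻ z in ball (0 : ℂ) 1, G z =
      ∫⁻ x in Ioo (0 : ℝ) 1 ×ˢ Ioo (-π) π, ENNReal.ofReal x.1 * G (circleMap 0 x.1 x.2) := by
  rw [← lintegral_indicator measurableSet_ball, ← Complex.lintegral_comp_polarCoord_symm,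
    ← lintegral_indicator (measurableSet_Ioo.prod measurableSet_Ioo),
    ← lintegral_indicator polarCoord.open_target.measurableSet, polarCoord_target]
  refine lintegral_congr fun x => ?_
  have hz : Complex.polarCoord.symm x = circleMap 0 x.1 x.2 := by
    rw [Complex.polarCoord_symm_apply, circleMap, Complex.exp_mul_I, zero_add,
      Complex.ofReal_cos, Complex.ofReal_sin]
  simp only [indicator_apply, hz, mem_prod, mem_Ioi, mem_Ioo, smul_eq_mul]
  by_cases h0 : 0 < x.1
  · by_cases h1 : x.1 < 1 <;> simp [h0, h1, abs_of_pos h0]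
  · simp [h0]

lemma measurable_uncurry_enorm_deriv_circleMap (F : ℂ → ℂ) :
    Measurable fun x : ℝ × ℝ => ‖deriv F (circleMap 0 x.1 x.2)‖ₑ := by
  have h : Continuous fun x : ℝ × ℝ => circleMap 0 x.1 x.2 := by
    unfold circleMap
    fun_prop
  exact ((measurable_deriv F).comp h.measurable).enorm

lemma measurable_lintegral_Ioo_right {f : ℝ → ℝ → ℝ≥0∞}
    (hf : Measurable fun x : ℝ × ℝ => f x.1 x.2) :
    Measurable fun x : ℝ × ℝ => ∫⁻ ρ in Ioo x.1 1, f ρ x.2 := by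
  let s : Set ((ℝ × ℝ) × ℝ) := {y | y.1.1 < y.2 ∧ y.2 < 1}
  have hs : MeasurableSet s :=
    (measurableSet_lt (measurable_fst.comp measurable_fst) measurable_snd).inter
      (measurableSet_lt measurable_snd measurable_const)
  have hm : Measurable (s.indicator fun y => f y.2 y.1.2) :=
    (hf.comp (measurable_snd.prodMk (measurable_snd.comp measurable_fst))).indicator hs
  convert hm.lintegral_prod_right' (ν := volume) using 2 with x
  rw [← lintegral_indicator measurableSet_Ioo]
  refine lintegral_congr fun ρ => ?_
  simp only [indicator_apply, s, mem_ofPred_eq, mem_Ioo]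

/-- If `1 - |F|` tends to `0` in mean at the boundary, the area integral of
`((1 - |F|) / (1 - |z|)) ^ q (1 - |z|) ^ β` is controlled by that of `|F'| ^ q (1 - |z|) ^ β`. -/
lemma lintegral_one_sub_norm_rpow_lt_top {F : ℂ → ℂ} (hF : DifferentiableOn ℂ F (ball 0 1))
    (hlim : Tendsto (fun r => ∫⁻ θ in Ioo (-π) π, ENNReal.ofReal (1 - ‖F (circleMap 0 r θ)‖))
      (𝓝[<] 1) (𝓝 0)) {q β : ℝ} (hq : 1 < q) (hβ : β < q - 1)
    (hI : ∫⁻ z in ball (0 : ℂ) 1, ENNReal.ofReal ((1 - ‖z‖) ^ β) * ‖deriv F z‖ₑ ^ q < ∞) :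
    ∫⁻ z in ball (0 : ℂ) 1,
      ENNReal.ofReal ((1 - ‖z‖) ^ (β - q)) * ENNReal.ofReal (1 - ‖F z‖) ^ q < ∞ := by
  obtain ⟨C, hC, hardy⟩ := hardy_lintegral_le hq hβ
  set f : ℝ → ℝ → ℝ≥0∞ := fun ρ θ => ‖deriv F (circleMap 0 ρ θ)‖ₑ
  have hfm : Measurable fun x : ℝ × ℝ => f x.1 x.2 := measurable_uncurry_enorm_deriv_circleMap F
  have hfθ : ∀ θ, Measurable fun ρ => f ρ θ := fun θ => by
    have hc : Measurable fun ρ : ℝ => circleMap 0 ρ θ := by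
      unfold circleMap
      fun_prop
    exact ((measurable_deriv F).comp hc).enorm
  have hwm : ∀ e : ℝ, Measurable fun r : ℝ => ENNReal.ofReal (r * (1 - r) ^ e) := fun e =>
    (measurable_id.mul ((measurable_const.sub measurable_id).pow_const e)).ennreal_ofReal
  have hHm : Measurable fun x : ℝ × ℝ => ∫⁻ ρ in Ioo x.1 1, f ρ x.2 :=
    measurable_lintegral_Ioo_right hfm
  have h2 : (2 : ℝ≥0∞) ^ (q - 1) ≠ ∞ := ENNReal.rpow_ne_top_of_nonneg (by linarith) (by simp)
  have hIpolar : ∫⁻ z in ball (0 : ℂ) 1, ENNReal.ofReal ((1 - ‖z‖) ^ β) * ‖deriv F z‖ₑ ^ q =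
      ∫⁻ θ in Ioo (-π) π, ∫⁻ ρ in Ioo 0 1, ENNReal.ofReal (ρ * (1 - ρ) ^ β) * f ρ θ ^ q := by
    have hm : Measurable fun x : ℝ × ℝ => ENNReal.ofReal (x.1 * (1 - x.1) ^ β) * f x.1 x.2 ^ q :=
      ((hwm β).comp measurable_fst).mul (hfm.pow_const q)
    rw [lintegral_unitBall_eq_polar, ← lintegral_lintegral_swap hm.aemeasurable,
      lintegral_lintegral hm.aemeasurable, Measure.prod_restrict]
    refine setLIntegral_congr_fun (measurableSet_Ioo.prod measurableSet_Ioo) fun x hx => ?_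
    simp only [norm_circleMap_zero, abs_of_pos hx.1.1]
    rw [← mul_assoc, ← ENNReal.ofReal_mul hx.1.1.le]
  rw [hIpolar] at hI
  calc _ = ∫⁻ x in Ioo (0 : ℝ) 1 ×ˢ Ioo (-π) π, ENNReal.ofReal (x.1 * (1 - x.1) ^ (β - q)) *
          ENNReal.ofReal (1 - ‖F (circleMap 0 x.1 x.2)‖) ^ q := by
        rw [lintegral_unitBall_eq_polar]
        refine setLIntegral_congr_fun (measurableSet_Ioo.prod measurableSet_Ioo) fun x hx => ?_
        simp only [norm_circleMap_zero, abs_of_pos hx.1.1]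
        rw [← mul_assoc, ← ENNReal.ofReal_mul hx.1.1.le]
    _ ≤ ∫⁻ r in Ioo 0 1, ∫⁻ θ in Ioo (-π) π, ENNReal.ofReal (r * (1 - r) ^ (β - q)) *
          ENNReal.ofReal (1 - ‖F (circleMap 0 r θ)‖) ^ q := by
        rw [Measure.volume_eq_prod, ← Measure.prod_restrict]
        exact lintegral_prod_le _
    _ ≤ ∫⁻ r in Ioo 0 1, 2 ^ (q - 1) * ∫⁻ θ in Ioo (-π) π,
          ENNReal.ofReal (r * (1 - r) ^ (β - q)) * (∫⁻ ρ in Ioo r 1, f ρ θ) ^ q := by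
        refine setLIntegral_mono' measurableSet_Ioo fun r hr => ?_
        rw [lintegral_const_mul' _ _ (by simp), lintegral_const_mul' _ _ (by simp),
          mul_left_comm]
        exact mul_le_mul_right (lintegral_one_sub_norm_rpow_le hF hlim hq.le hr.1.le hr.2) _
    _ = 2 ^ (q - 1) * ∫⁻ θ in Ioo (-π) π, ∫⁻ r in Ioo 0 1,
          ENNReal.ofReal (r * (1 - r) ^ (β - q)) * (∫⁻ ρ in Ioo r 1, f ρ θ) ^ q := by
        have hm : Measurable fun x : ℝ × ℝ => ENNReal.ofReal (x.1 * (1 - x.1) ^ (β - q)) *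
            (∫⁻ ρ in Ioo x.1 1, f ρ x.2) ^ q :=
          ((hwm (β - q)).comp measurable_fst).mul (hHm.pow_const q)
        rw [lintegral_const_mul' _ _ h2, lintegral_lintegral_swap hm.aemeasurable]
    _ ≤ 2 ^ (q - 1) * ∫⁻ θ in Ioo (-π) π, C * ∫⁻ ρ in Ioo 0 1,
          ENNReal.ofReal (ρ * (1 - ρ) ^ β) * f ρ θ ^ q := by
        refine mul_le_mul_right (lintegral_mono fun θ => ?_) _
        exact hardy (fun ρ => f ρ θ) (hfθ θ)
    _ < ∞ := by
        rw [lintegral_const_mul' _ _ hC]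
        exact ENNReal.mul_lt_top h2.lt_top (ENNReal.mul_lt_top hC.lt_top hI)

/-- Multiplying `|B'| ^ p (1 - |z|) ^ α` by the bounded function `|B'| (1 - |z|)` raises the
exponent without changing `2 - p + α`. -/
lemma IsBlaschkeSequence.lintegral_deriv_rpow_add_one_lt_top {a : ℕ → ℂ}
    (ha : IsBlaschkeSequence a) {p α : ℝ} (hp : 0 < p)
    (hB : IntegrableOn (fun z : ℂ => ‖deriv (blaschkeProduct a) z‖ ^ p * (1 - ‖z‖) ^ α)
      (ball 0 1) volume) :
    ∫⁻ z in ball (0 : ℂ) 1, ENNReal.ofReal ((1 - ‖z‖) ^ (α + 1)) *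
      ‖deriv (blaschkeProduct a) z‖ₑ ^ (p + 1) < ∞ := by
  refine lt_of_le_of_lt ?_ (ENNReal.mul_lt_top (a := 2) (by simp) hB.lintegral_lt_top)
  rw [← lintegral_const_mul' _ _ (by simp)]
  refine setLIntegral_mono' measurableSet_ball fun z hz => ?_
  have hz1 : 0 < 1 - ‖z‖ := sub_pos.mpr (mem_ball_zero_iff.mp hz)
  have hd := ha.norm_deriv_blaschkeProduct_le (mem_ball_zero_iff.mp hz)
  rw [le_div_iff₀ hz1] at hd
  set x := ‖deriv (blaschkeProduct a) z‖ with hx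
  have hx0 : 0 ≤ x := norm_nonneg _
  rw [← ofReal_norm, ← hx, ENNReal.ofReal_rpow_of_nonneg hx0 (by linarith),
    ← ENNReal.ofReal_mul (by positivity), show (2 : ℝ≥0∞) = ENNReal.ofReal 2 by simp,
    ← ENNReal.ofReal_mul (by norm_num)]
  refine ENNReal.ofReal_le_ofReal ?_
  rw [Real.rpow_add_one hz1.ne', Real.rpow_add_one' hx0 (by linarith)]
  calc _ = x * (1 - ‖z‖) * (x ^ p * (1 - ‖z‖) ^ α) := by ring
    _ ≤ _ := by gcongr

/-- Separation makes the Euclidean discs of radius proportional to the distance to the unit circle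
disjoint. -/
lemma disjoint_ball_of_le_pseudohyperbolicDist {a b : ℂ} {c δ : ℝ} (ha : ‖a‖ < 1) (hb : ‖b‖ < 1)
    (hc : 2 * c ≤ δ) (h : δ ≤ pseudohyperbolicDist a b) :
    Disjoint (ball a (c * (1 - ‖a‖))) (ball b (c * (1 - ‖b‖))) := by
  rcases le_or_gt c 0 with hc0 | hc0
  · rw [ball_eq_empty.mpr (mul_nonpos_of_nonpos_of_nonneg hc0 (by linarith))]
    exact empty_disjoint _
  rw [Set.disjoint_left]
  intro z hza hzb
  have h1 := one_sub_norm_le_norm_one_sub_conj_mul (a := b) ha.le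
  have h2 := one_sub_norm_le_norm_one_sub_conj_mul' (z := a) hb.le
  have h3 : 0 < ‖1 - conj b * a‖ := by linarith
  have h4 : ‖a - b‖ < c * (1 - ‖a‖) + c * (1 - ‖b‖) := by
    rw [← dist_eq_norm]
    exact (dist_triangle_left a b z).trans_lt (add_lt_add hza hzb)
  rw [pseudohyperbolicDist, norm_div, le_div_iff₀ h3] at h
  have h5 := mul_le_mul_of_nonneg_left h1 hc0.le
  have h6 := mul_le_mul_of_nonneg_left h2 hc0.le
  have h7 := mul_le_mul_of_nonneg_right hc h3.le
  linarith

lemma norm_blaschkeFactor_le_of_mem_ball {a z : ℂ} {c : ℝ} (ha0 : a ≠ 0) (ha : ‖a‖ < 1)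
    (hz1 : ‖z‖ ≤ 1) (hz : z ∈ ball a (c * (1 - ‖a‖))) : ‖blaschkeFactor a z‖ ≤ c := by
  have h1 := one_sub_norm_le_norm_one_sub_conj_mul (a := a) hz1
  rw [mem_ball, dist_eq_norm] at hz
  have hc : 0 ≤ c := by
    by_contra! hc
    nlinarith [norm_nonneg (z - a)]
  rw [norm_blaschkeFactor ha0, div_le_iff₀ (by linarith)]
  exact hz.le.trans (mul_le_mul_of_nonneg_left h1 hc)

theorem theorem1 (a : ℕ → ℂ) (ha : IsBlaschkeSequence a) (hd : UniformlyDiscrete a)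
    (p α : ℝ) (hα : -1 < α) (hp₁ : α + 1 < p) (hp₂ : p < α + 2)
    (hB : MemBergman p α (deriv (blaschkeProduct a))) :
    Summable fun n => (1 - ‖a n‖) ^ (2 - p + α) := by
  obtain ⟨δ, hδ, hsep⟩ := hd
  -- The exponents `q = p + 1` and `β = α + 1` satisfy `β - q = α - p`.
  have hJ := lintegral_one_sub_norm_rpow_lt_top ha.differentiableOn_blaschkeProduct
    ha.tendsto_lintegral_one_sub_norm_blaschkeProduct (q := p + 1) (β := α + 1) (by linarith)
    (by linarith) (ha.lintegral_deriv_rpow_add_one_lt_top (by linarith) hB.integrable)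
  rw [show α + 1 - (p + 1) = α - p by ring] at hJ
  set G : ℂ → ℝ≥0∞ := fun z => ENNReal.ofReal ((1 - ‖z‖) ^ (α - p)) *
    ENNReal.ofReal (1 - ‖blaschkeProduct a z‖) ^ (p + 1)
  -- `2 c ≤ δ` gives disjoint discs, and `c ≤ 1 / 2` gives `1 - |B| ≥ 1 / 2` on each of them.
  set c := min (δ / 2) (1 / 2)
  have hc0 : 0 < c := lt_min (by linarith) (by norm_num)
  have hc1 : c ≤ 1 / 2 := min_le_right _ _
  have hc2 : 2 * c ≤ δ := by linarith [min_le_left (δ / 2) (1 / 2 : ℝ)]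
  set E : ℕ → Set ℂ := fun n => ball (a n) (c * (1 - ‖a n‖))
  have ht : ∀ n, 0 < 1 - ‖a n‖ := fun n => sub_pos.mpr (ha.norm_lt_one n)
  have hdist : ∀ n, ∀ z ∈ E n, |‖z‖ - ‖a n‖| < c * (1 - ‖a n‖) := fun n z hz => by
    rw [mem_ball, dist_eq_norm] at hz
    exact (abs_norm_sub_norm_le z (a n)).trans_lt hz
  have hE : ∀ n, E n ⊆ ball 0 1 := fun n z hz => by
    rw [mem_ball_zero_iff]
    nlinarith [(abs_lt.mp (hdist n z hz)).2, ht n]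
  set K : ℝ≥0∞ := ENNReal.ofReal (2 ^ (α - p) * (1 / 2) ^ (p + 1) * (c ^ 2 * π))
  have hK : K ≠ 0 := by
    rw [Ne, ENNReal.ofReal_eq_zero, not_le]
    positivity
  have hlow : ∀ n, K * ENNReal.ofReal ((1 - ‖a n‖) ^ (2 - p + α)) ≤ ∫⁻ z in E n, G z := by
    intro n
    have h1 := ht n
    calc _ = ∫⁻ _ in E n, ENNReal.ofReal ((2 * (1 - ‖a n‖)) ^ (α - p) * (1 / 2) ^ (p + 1)) := by
          rw [setLIntegral_const, Complex.volume_ball, ← ENNReal.ofReal_pow (by positivity),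
            show (NNReal.pi : ℝ≥0∞) = ENNReal.ofReal π by
              rw [← NNReal.coe_real_pi, ENNReal.ofReal_coe_nnreal],
            ← ENNReal.ofReal_mul (by positivity), ← ENNReal.ofReal_mul (by positivity),
            ← ENNReal.ofReal_mul (by positivity), Real.mul_rpow (by norm_num) h1.le,
            show 2 - p + α = (α - p) + (2 : ℕ) by push_cast; ring, Real.rpow_add_natCast h1.ne']
          congr 1
          ring
      _ ≤ _ := by
          refine setLIntegral_mono' measurableSet_ball fun z hz => ?_
          have hz1 := mem_ball_zero_iff.mp (hE n hz)
          have hz2 := (ha.norm_blaschkeProduct_le_factor n hz1).trans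
            (norm_blaschkeFactor_le_of_mem_ball (ha.ne_zero n) (ha.norm_lt_one n) hz1.le hz)
          have hz3 : 1 - ‖z‖ ≤ 2 * (1 - ‖a n‖) := by
            nlinarith [(abs_lt.mp (hdist n z hz)).1]
          rw [ENNReal.ofReal_mul (by positivity),
            ← ENNReal.ofReal_rpow_of_nonneg (p := p + 1) (by norm_num) (by linarith)]
          refine mul_le_mul' (ENNReal.ofReal_le_ofReal ?_)
            (ENNReal.rpow_le_rpow (ENNReal.ofReal_le_ofReal ?_) (by linarith))
          · exact Real.rpow_le_rpow_of_nonpos (by linarith) hz3 (by linarith)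
          · linarith
  have hsum : K * ∑' n, ENNReal.ofReal ((1 - ‖a n‖) ^ (2 - p + α)) < ∞ := by
    calc _ = ∑' n, K * ENNReal.ofReal ((1 - ‖a n‖) ^ (2 - p + α)) := ENNReal.tsum_mul_left.symm
      _ ≤ ∑' n, ∫⁻ z in E n, G z := ENNReal.tsum_le_tsum hlow
      _ = ∫⁻ z in ⋃ n, E n, G z := (lintegral_iUnion (fun n => measurableSet_ball)
          (fun m n hmn => disjoint_ball_of_le_pseudohyperbolicDist (ha.norm_lt_one m)
            (ha.norm_lt_one n) hc2 (hsep m n hmn)) _).symm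
      _ ≤ ∫⁻ z in ball 0 1, G z := lintegral_mono_set (iUnion_subset hE)
      _ < ∞ := hJ
  have hne : ∑' n, ENNReal.ofReal ((1 - ‖a n‖) ^ (2 - p + α)) ≠ ∞ :=
    fun h => by simp [h, ENNReal.mul_top hK] at hsum
  refine (ENNReal.summable_toReal hne).congr fun n => ?_
  exact ENNReal.toReal_ofReal (Real.rpow_nonneg (ht n).le _)
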